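/- Let $p \ge 1$, let $\mathcal X \subseteq \mathbb S_{++}^p$ be any set of positive definite real symmetric $p\times p$ matrices (the admissible precision matrices), and let $\rho > 0$. For $\hat\mu\in\mathbb R^p$ and $\hat\Sigma \in \mathbb S_+^p$ (positive semidefinite), let $\mathcal P_\rho(\hat\mu,\hat\Sigma)$ be the set of all (possibly degenerate) normal distributions $\mathbb Q$ on $\mathbb R^p$ with $W_2(\mathcal N(\hat\mu,\hat\Sigma),\mathbb Q)\le \rho$, where $$W_2(\mathbb P_1,\mathbb P_2)=\inf_{\Pi}\Big(\int \|\xi_1-\xi_2\|^2\,\Pi(d\xi_1,d\xi_2)\Big)^{1/2}$$ and $\Pi$ ranges over the joint distributions with marginals $\mathbb P_1$ and $\mathbb P_2$. Consider the general distributionally robust estimation problem $$\mathcal J(\hat\mu,\hat\Sigma)=\inf_{\mu\in\mathbb R^p,\;X\in\mathcal X}\; F_{\hat\mu,\hat\Sigma}(\mu,X),\qquad F_{\hat\mu,\hat\Sigma}(\mu,X) = -\log\det X+\sup_{\mathbb Q\in\mathcal P_\rho(\hat\mu,\hat\Sigma)}\mathbb E^{\mathbb Q}\big[(\xi-\mu)^\top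 X(\xi-\mu)\big],$$ where an infimum over the empty set is $+\infty$. Then for all $\hat\mu\in\mathbb R^p$ and $\hat\Sigma\in\mathbb S_+^p$ this problem is equivalent to the optimization problem $$\inf_{X,\gamma}\Big\{-\log\det X+\gamma\big(\rho^2-\operatorname{Tr}\hat\Sigma\big)+\gamma^2\big\langle(\gamma I-X)^{-1},\hat\Sigma\big\rangle \;:\; \gamma I\succ X\succ 0,\; X\in\mathcal X\Big\}$$ and to the semidefinite program $$\inf_{X,Y,\gamma}\Big\{-\log\det X+\gamma\big(\rho^2-\operatorname{Tr}\hat\Sigma\big)+\operatorname{Tr}Y \;:\; \begin{bmatrix}Y&\gamma\hat\Sigma^{1/2}\\ \gamma\hat\Sigma^{1/2}&\gamma I-X\end{bmatrix}\succeq 0,\; \gamma I\succ X\succ 0,\; Y\succeq 0,\; X\in\mathcal X\Big\},$$ where $\langle A,B\rangle=\operatorname{Tr}(A^\top B)$. Here "equivalent" means that the three optimal values coincide and, moreover, that for every fixed $X\in\mathcal X$ the infimum of $F_{\hat\mu,\hat\Sigma}(\mu,X)$ over $\mu\in\mathbb R^p$ is attained at $\mu=\hat\mu$ and equals the infimum of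 the objective of the second problem over all $\gamma$ feasible for this $X$, and also the infimum of the objective of the third problem over all $(Y,\gamma)$ feasible for this $X$. The optimal value $\mathcal J(\hat\mu,\hat\Sigma)$ is finite if $\mathcal X\ne\emptyset$. Moreover, $\mathcal J(\hat\mu,\hat\Sigma)$ is constant in $\hat\mu\in\mathbb R^p$ and continuous in $\hat\Sigma\in\mathbb S_+^p$. -/

import Mathlib

open MeasureTheory ProbabilityTheory Matrix
open scoped ENNReal MatrixOrder

noncomputable section

namespace WassersteinShrinkage

/-- The type-2 Wasserstein distance between two measures on `ℝ^p`: the infimum, over all joint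
distributions `π` with marginals `P₁` and `P₂`, of `(∫ ‖ξ₁ - ξ₂‖² dπ)^(1/2)`. -/
def wassersteinDist {p : ℕ} (P₁ P₂ : Measure (EuclideanSpace ℝ (Fin p))) : ℝ≥0∞ :=
  ⨅ (π : Measure (EuclideanSpace ℝ (Fin p) × EuclideanSpace ℝ (Fin p)))
    (_ : π.map Prod.fst = P₁ ∧ π.map Prod.snd = P₂),
    (∫⁻ z, ‖z.1 - z.2‖ₑ ^ 2 ∂π) ^ (1 / 2 : ℝ)

/-- The family of all (possibly degenerate) normal distributions on `ℝ^p`. -/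
def normalFamily (p : ℕ) : Set (Measure (EuclideanSpace ℝ (Fin p))) :=
  {Q | ∃ (m : EuclideanSpace ℝ (Fin p)) (C : Matrix (Fin p) (Fin p) ℝ),
    C.PosSemidef ∧ Q = multivariateGaussian m C}

/-- The ambiguity set: all normal distributions whose type-2 Wasserstein distance to the empirical
distribution `N(muHat, S)` is at most `ρ`. Here `S` is the sample covariance matrix. -/
def ambiguitySet {p : ℕ} (ρ : ℝ) (muHat : EuclideanSpace ℝ (Fin p))
    (S : Matrix (Fin p) (Fin p) ℝ) : Set (Measure (EuclideanSpace ℝ (Fin p))) :=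
  {Q | Q ∈ normalFamily p ∧
    wassersteinDist (multivariateGaussian muHat S) Q ≤ ENNReal.ofReal ρ}

/-- The quadratic form `vᵀ X v`. -/
def quadForm {p : ℕ} (X : Matrix (Fin p) (Fin p) ℝ) (v : EuclideanSpace ℝ (Fin p)) : ℝ :=
  v.ofLp ⬝ᵥ (X *ᵥ v.ofLp)

/-- The inner product `⟨A, B⟩ = Tr(Aᵀ B)`. -/
def matrixInner {p : ℕ} (A B : Matrix (Fin p) (Fin p) ℝ) : ℝ :=
  (Aᵀ * B).trace

/-- The objective function of the distributionally robust estimation problem: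
`-log det X + sup_Q E^Q[(ξ - μ)ᵀ X (ξ - μ)]`, with `Q` ranging over the ambiguity set. -/
def droObjective {p : ℕ} (ρ : ℝ) (muHat : EuclideanSpace ℝ (Fin p))
    (S : Matrix (Fin p) (Fin p) ℝ) (μ : EuclideanSpace ℝ (Fin p))
    (X : Matrix (Fin p) (Fin p) ℝ) : EReal :=
  ((-Real.log X.det : ℝ) : EReal) +
    ⨆ Q ∈ ambiguitySet ρ muHat S, ((∫ ξ, quadForm X (ξ - μ) ∂Q : ℝ) : EReal)

/-- The optimal value of the distributionally robust estimation problem with unknown mean: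
the infimum of its objective over all `μ ∈ ℝ^p` and all admissible `X ∈ 𝒳`. -/
def droValue {p : ℕ} (𝒳 : Set (Matrix (Fin p) (Fin p) ℝ)) (ρ : ℝ)
    (muHat : EuclideanSpace ℝ (Fin p)) (S : Matrix (Fin p) (Fin p) ℝ) : EReal :=
  ⨅ (μ : EuclideanSpace ℝ (Fin p)) (X ∈ 𝒳), droObjective ρ muHat S μ X

/-- Feasibility in the convex program: `γ I ≻ X ≻ 0` and `X ∈ 𝒳`. -/
def ConvexFeasible {p : ℕ} (𝒳 : Set (Matrix (Fin p) (Fin p) ℝ))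
    (X : Matrix (Fin p) (Fin p) ℝ) (γ : ℝ) : Prop :=
  (γ • (1 : Matrix (Fin p) (Fin p) ℝ) - X).PosDef ∧ X.PosDef ∧ X ∈ 𝒳

/-- The objective of the convex program:
`-log det X + γ (ρ² - Tr S) + γ² ⟨(γ I - X)⁻¹, S⟩`. -/
def convexObjective {p : ℕ} (ρ : ℝ) (S : Matrix (Fin p) (Fin p) ℝ)
    (X : Matrix (Fin p) (Fin p) ℝ) (γ : ℝ) : ℝ :=
  -Real.log X.det + γ * (ρ ^ 2 - S.trace) +
    γ ^ 2 * matrixInner (γ • (1 : Matrix (Fin p) (Fin p) ℝ) - X)⁻¹ S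

/-- The optimal value of the convex program. -/
def convexValue {p : ℕ} (𝒳 : Set (Matrix (Fin p) (Fin p) ℝ)) (ρ : ℝ)
    (S : Matrix (Fin p) (Fin p) ℝ) : EReal :=
  ⨅ (X : Matrix (Fin p) (Fin p) ℝ) (γ : ℝ) (_ : ConvexFeasible 𝒳 X γ),
    ((convexObjective ρ S X γ : ℝ) : EReal)

/-- Feasibility in the semidefinite program: the block matrix
`[[Y, γ S^(1/2)], [γ S^(1/2), γ I - X]]` is positive semidefinite,
`γ I ≻ X ≻ 0`, `Y ⪰ 0` and `X ∈ 𝒳`. -/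
def SdpFeasible {p : ℕ} (𝒳 : Set (Matrix (Fin p) (Fin p) ℝ)) (S : Matrix (Fin p) (Fin p) ℝ)
    (X Y : Matrix (Fin p) (Fin p) ℝ) (γ : ℝ) : Prop :=
  (Matrix.fromBlocks Y (γ • CFC.sqrt S) (γ • CFC.sqrt S)
    (γ • (1 : Matrix (Fin p) (Fin p) ℝ) - X)).PosSemidef ∧
  (γ • (1 : Matrix (Fin p) (Fin p) ℝ) - X).PosDef ∧ X.PosDef ∧ Y.PosSemidef ∧ X ∈ 𝒳

/-- The objective of the semidefinite program: `-log det X + γ (ρ² - Tr S) + Tr Y`. -/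
def sdpObjective {p : ℕ} (ρ : ℝ) (S : Matrix (Fin p) (Fin p) ℝ)
    (X Y : Matrix (Fin p) (Fin p) ℝ) (γ : ℝ) : ℝ :=
  -Real.log X.det + γ * (ρ ^ 2 - S.trace) + Y.trace

/-- The optimal value of the semidefinite program. -/
def sdpValue {p : ℕ} (𝒳 : Set (Matrix (Fin p) (Fin p) ℝ)) (ρ : ℝ)
    (S : Matrix (Fin p) (Fin p) ℝ) : EReal :=
  ⨅ (X : Matrix (Fin p) (Fin p) ℝ) (Y : Matrix (Fin p) (Fin p) ℝ) (γ : ℝ)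
    (_ : SdpFeasible 𝒳 S X Y γ), ((sdpObjective ρ S X Y γ : ℝ) : EReal)

end WassersteinShrinkage

end

/-! The number `γ` is a Lagrange multiplier for the transport budget `ρ²`. Write `D = γI - X ≻ 0`
and `T = γD⁻¹`. Completing the square in `b` turns `bᵀXb - γ‖a - b‖²` into `aᵀKa - (b - Ta)ᵀD(b -
Ta)` with `K = γ²D⁻¹ - γI` (`dotProduct_mulVec_complete_square`).

Weak duality: integrating `bᵀXb ≤ γ‖a - b‖² + aᵀKa` against a coupling bounds the worst-case risk
centred at `μ̂` by `γρ² + Tr(KΣ̂)`, which is the convex objective without `-log det X`.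

Strong duality: push the empirical law forward by `T` and spend what is left of the budget, `c² = ρ²
- E‖a - Ta‖²`, on independent Gaussian noise along a unit top eigenvector `v` of `X`
(`exists_mem_ambiguitySet_le_integral`). The law is again normal and its duality gap is at most
`c²(γ - vᵀXv)`. An intermediate value argument makes this arbitrarily small (`exists_multiplier`);
the noise handles the case where even `γ` close to `λ_max(X)` does not use up the budget, for
instance when `Σ̂` is singular. Centring at `μ ≠ μ̂` adds `(μ̂ - μ)ᵀX(μ̂ - μ) ≥ 0`, so `μ̂` is
optimal and the value does not depend on it.

The SDP follows by a Schur complement. Finiteness and continuity in `Σ̂` rest on coercivity in `γ`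
uniform in `X` and `Σ̂`, and on a Lipschitz estimate uniform in `X`, obtained by slightly increasing
`γ`. -/

namespace WassersteinShrinkage

variable {p : ℕ}

/-- The matrix `γ² (γ I - X)⁻¹ - γ I` of the quadratic form
`a ↦ sup_b (bᵀ X b - γ ‖a - b‖²)`. -/
noncomputable def dualMatrix (X : Matrix (Fin p) (Fin p) ℝ) (γ : ℝ) : Matrix (Fin p) (Fin p) ℝ :=
  γ ^ 2 • (γ • (1 : Matrix (Fin p) (Fin p) ℝ) - X)⁻¹ - γ • 1

/-- The matrix `γ (γ I - X)⁻¹` of the linear map sending `a` to the maximiser of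
`b ↦ bᵀ X b - γ ‖a - b‖²`. -/
noncomputable def transportMatrix (X : Matrix (Fin p) (Fin p) ℝ) (γ : ℝ) :
    Matrix (Fin p) (Fin p) ℝ :=
  γ • (γ • (1 : Matrix (Fin p) (Fin p) ℝ) - X)⁻¹

/-! ### Quadratic forms, their dual matrices and traces -/

section QuadraticForms

variable {X : Matrix (Fin p) (Fin p) ℝ} {γ : ℝ}

lemma dotProduct_mulVec_complete_square
    (hD : (γ • (1 : Matrix (Fin p) (Fin p) ℝ) - X).PosDef) (a b : Fin p → ℝ) :
    b ⬝ᵥ X *ᵥ b = γ * ((a - b) ⬝ᵥ (a - b)) + a ⬝ᵥ dualMatrix X γ *ᵥ a -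
      (b - transportMatrix X γ *ᵥ a) ⬝ᵥ
        ((γ • (1 : Matrix (Fin p) (Fin p) ℝ) - X) *ᵥ (b - transportMatrix X γ *ᵥ a)) := by
  set D := γ • (1 : Matrix (Fin p) (Fin p) ℝ) - X with hDdef
  have hX : X = γ • 1 - D := by rw [hDdef]; abel
  set r := D⁻¹ *ᵥ a with hr
  have hDr : D *ᵥ r = a := by
    rw [hr, mulVec_mulVec, mul_nonsing_inv _ ((isUnit_iff_isUnit_det _).1 hD.isUnit), one_mulVec]
  have hsymm : r ⬝ᵥ D *ᵥ b = a ⬝ᵥ b := by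
    rw [dotProduct_mulVec, ← mulVec_transpose, show Dᵀ = D from hD.isHermitian, hDr]
  have hT : transportMatrix X γ *ᵥ a = γ • r := by
    rw [transportMatrix, smul_mulVec]
  have hK : dualMatrix X γ *ᵥ a = γ ^ 2 • r - γ • a := by
    rw [dualMatrix, sub_mulVec, smul_mulVec, smul_mulVec, one_mulVec]
  have hXb : X *ᵥ b = γ • b - D *ᵥ b := by
    rw [hX, sub_mulVec, smul_mulVec, one_mulVec]
  rw [hT, hK, hXb, mulVec_sub, mulVec_smul, hDr]
  simp only [dotProduct_sub, sub_dotProduct, dotProduct_smul, smul_dotProduct, smul_eq_mul, hsymm]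
  rw [dotProduct_comm b a, dotProduct_comm r a]
  ring

lemma dotProduct_mulVec_le_cost_add_dual
    (hD : (γ • (1 : Matrix (Fin p) (Fin p) ℝ) - X).PosDef) (a b : Fin p → ℝ) :
    b ⬝ᵥ X *ᵥ b ≤ γ * ((a - b) ⬝ᵥ (a - b)) + a ⬝ᵥ dualMatrix X γ *ᵥ a := by
  have h := hD.posSemidef.dotProduct_mulVec_nonneg (b - transportMatrix X γ *ᵥ a)
  rw [star_trivial] at h
  linarith [dotProduct_mulVec_complete_square hD a b]

lemma dual_eq_transport
    (hD : (γ • (1 : Matrix (Fin p) (Fin p) ℝ) - X).PosDef) (a : Fin p → ℝ) :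
    a ⬝ᵥ dualMatrix X γ *ᵥ a =
      (transportMatrix X γ *ᵥ a) ⬝ᵥ X *ᵥ (transportMatrix X γ *ᵥ a) -
        γ * ((a - transportMatrix X γ *ᵥ a) ⬝ᵥ (a - transportMatrix X γ *ᵥ a)) := by
  have h := dotProduct_mulVec_complete_square hD a (transportMatrix X γ *ᵥ a)
  rw [sub_self, zero_dotProduct] at h
  linarith

lemma dual_nonneg (hX : X.PosSemidef)
    (hD : (γ • (1 : Matrix (Fin p) (Fin p) ℝ) - X).PosDef) (a : Fin p → ℝ) :
    0 ≤ a ⬝ᵥ dualMatrix X γ *ᵥ a := by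
  have h := dotProduct_mulVec_le_cost_add_dual hD a a
  have h' := hX.dotProduct_mulVec_nonneg a
  rw [star_trivial] at h'
  rw [sub_self, zero_dotProduct] at h
  linarith

lemma dotProduct_self_nonneg_real (a : Fin p → ℝ) : 0 ≤ a ⬝ᵥ a :=
  Finset.sum_nonneg fun i _ => mul_self_nonneg (a i)

lemma posDef_smul_one_sub_of_le {γ' : ℝ} (hD : (γ • (1 : Matrix (Fin p) (Fin p) ℝ) - X).PosDef)
    (h : γ ≤ γ') : (γ' • (1 : Matrix (Fin p) (Fin p) ℝ) - X).PosDef := by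
  have : γ' • (1 : Matrix (Fin p) (Fin p) ℝ) - X = (γ • 1 - X) + (γ' - γ) • 1 := by
    rw [sub_smul]; abel
  rw [this]
  exact hD.add_posSemidef (PosSemidef.one.smul (sub_nonneg.2 h))

/-- The dual form is a supremum over `b` of functions that decrease in `γ`. -/
lemma dual_antitone {γ' : ℝ} (hD : (γ • (1 : Matrix (Fin p) (Fin p) ℝ) - X).PosDef)
    (h : γ ≤ γ') (a : Fin p → ℝ) :
    a ⬝ᵥ dualMatrix X γ' *ᵥ a ≤ a ⬝ᵥ dualMatrix X γ *ᵥ a := by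
  rw [dual_eq_transport (posDef_smul_one_sub_of_le hD h)]
  have h1 := dotProduct_mulVec_le_cost_add_dual hD a (transportMatrix X γ' *ᵥ a)
  have h2 := mul_le_mul_of_nonneg_right h
    (dotProduct_self_nonneg_real (a - transportMatrix X γ' *ᵥ a))
  linarith

/-- Since `X ≺ γI`, the dual form at `γ + δ` is at most the supremum over `b` of `γ‖b‖² - (γ + δ)‖a
- b‖²`, which is attained at `b = ((γ + δ)/δ) a`. The bound does not involve `X`, which is what
continuity needs. -/
lemma dual_add_le {δ : ℝ} (hδ : 0 < δ)
    (hD : (γ • (1 : Matrix (Fin p) (Fin p) ℝ) - X).PosDef) (a : Fin p → ℝ) :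
    a ⬝ᵥ dualMatrix X (γ + δ) *ᵥ a ≤ γ * (γ + δ) / δ * (a ⬝ᵥ a) := by
  rw [dual_eq_transport (posDef_smul_one_sub_of_le hD (by linarith))]
  set b := transportMatrix X (γ + δ) *ᵥ a
  have h1 := hD.posSemidef.dotProduct_mulVec_nonneg b
  rw [star_trivial, sub_mulVec, smul_mulVec, one_mulVec, dotProduct_sub, dotProduct_smul,
    smul_eq_mul] at h1
  have h2 := dotProduct_self_nonneg_real (δ • b - (γ + δ) • a)
  simp only [dotProduct_sub, sub_dotProduct, dotProduct_smul, smul_dotProduct, smul_eq_mul] at h2 ⊢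
  rw [dotProduct_comm b a] at h2 ⊢
  rw [div_mul_eq_mul_div, le_div_iff₀ hδ]
  nlinarith [mul_le_mul_of_nonneg_left h1 hδ.le]

lemma transpose_inv_smul_one_sub (hD : (γ • (1 : Matrix (Fin p) (Fin p) ℝ) - X).PosDef) :
    ((γ • (1 : Matrix (Fin p) (Fin p) ℝ) - X)⁻¹)ᵀ =
      (γ • (1 : Matrix (Fin p) (Fin p) ℝ) - X)⁻¹ :=
  hD.inv.isHermitian

lemma dualMatrix_transpose (hD : (γ • (1 : Matrix (Fin p) (Fin p) ℝ) - X).PosDef) :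
    (dualMatrix X γ)ᵀ = dualMatrix X γ := by
  simp [dualMatrix, transpose_inv_smul_one_sub hD]

/-- A symmetric matrix whose quadratic form lies between `0` and `M ‖a‖²` has entries bounded
by `M`. -/
lemma abs_apply_le_of_quadratic_bound {A : Matrix (Fin p) (Fin p) ℝ} (hA : Aᵀ = A) {M : ℝ}
    (h0 : ∀ a : Fin p → ℝ, 0 ≤ a ⬝ᵥ A *ᵥ a) (hM : ∀ a : Fin p → ℝ, a ⬝ᵥ A *ᵥ a ≤ M * (a ⬝ᵥ a))
    (i j : Fin p) : |A i j| ≤ M := by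
  have hij : A j i = A i j := congrFun (congrFun hA i) j
  have e1 : ∀ i j : Fin p, Pi.single i (1 : ℝ) ⬝ᵥ A *ᵥ Pi.single j 1 = A i j := by simp
  by_cases hne : i = j
  · subst hne
    have h1 := h0 (Pi.single i 1)
    have h2 := hM (Pi.single i 1)
    rw [e1] at h1 h2
    rw [abs_of_nonneg h1]
    simpa using h2
  · have h1 := hM (Pi.single i 1)
    have h2 := hM (Pi.single j 1)
    -- Polarization: nonnegativity at `eᵢ ± eⱼ`, with diagonal entries at most `M`, bounds `A i j`
    -- from both sides.
    have h3 := h0 (Pi.single i 1 + Pi.single j 1)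
    have h4 := h0 (Pi.single i 1 - Pi.single j 1)
    simp only [mulVec_add, mulVec_sub, dotProduct_add, dotProduct_sub, add_dotProduct,
      sub_dotProduct, e1, hij] at h1 h2 h3 h4
    simp at h1 h2
    rw [abs_le]
    constructor <;> linarith

/-- `Tr(CS)` is the sum of the values of the form `C` at the rows of `S^(1/2)`. -/
lemma trace_mul_mono {A B S : Matrix (Fin p) (Fin p) ℝ} (hS : S.PosSemidef)
    (h : ∀ a : Fin p → ℝ, a ⬝ᵥ A *ᵥ a ≤ a ⬝ᵥ B *ᵥ a) : (A * S).trace ≤ (B * S).trace := by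
  have key : ∀ C : Matrix (Fin p) (Fin p) ℝ, (C * S).trace =
      ∑ i, (CFC.sqrt S).row i ⬝ᵥ C *ᵥ (CFC.sqrt S).row i := by
    intro C
    have hs : (CFC.sqrt S)ᵀ = CFC.sqrt S := (CFC.sqrt_nonneg S).posSemidef.isHermitian
    have : C * S = C * (CFC.sqrt S)ᵀ * CFC.sqrt S := by
      rw [hs, Matrix.mul_assoc, CFC.sqrt_mul_sqrt_self S hS.nonneg]
    rw [this, trace_mul_comm, ← Matrix.mul_assoc]
    simp only [trace, diag, Matrix.mul_apply, dotProduct, mulVec, transpose_apply, row_apply,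
      Finset.sum_mul, Finset.mul_sum]
    refine Finset.sum_congr rfl fun i _ => ?_
    rw [Finset.sum_comm]
    exact Finset.sum_congr rfl fun j _ => Finset.sum_congr rfl fun k _ => by ring
  rw [key, key]
  exact Finset.sum_le_sum fun i _ => h _

lemma abs_trace_mul_le {A B : Matrix (Fin p) (Fin p) ℝ} {M : ℝ} (hA : ∀ i j, |A i j| ≤ M) :
    |(A * B).trace| ≤ M * ∑ i, ∑ j, |B i j| := by
  rw [Finset.sum_comm]
  simp only [trace, diag, Matrix.mul_apply, Finset.mul_sum]
  refine (Finset.abs_sum_le_sum_abs _ _).trans (Finset.sum_le_sum fun i _ => ?_)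
  refine (Finset.abs_sum_le_sum_abs _ _).trans (Finset.sum_le_sum fun j _ => ?_)
  rw [abs_mul]
  exact mul_le_mul_of_nonneg_right (hA i j) (abs_nonneg _)

/-- A unit vector maximising the quadratic form characterises the `γ` with `γ I ≻ X`. -/
lemma exists_unit_maximizer (hp : 1 ≤ p) (hX : X.IsHermitian) :
    ∃ v : Fin p → ℝ, v ⬝ᵥ v = 1 ∧
      ∀ γ : ℝ, (γ • (1 : Matrix (Fin p) (Fin p) ℝ) - X).PosDef ↔ v ⬝ᵥ X *ᵥ v < γ := by
  have : Nonempty (Fin p) := ⟨⟨0, hp⟩⟩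
  have hquad : ∀ (γ : ℝ) (a : Fin p → ℝ),
      a ⬝ᵥ (γ • (1 : Matrix (Fin p) (Fin p) ℝ) - X) *ᵥ a = γ * (a ⬝ᵥ a) - a ⬝ᵥ X *ᵥ a := by
    intro γ a
    rw [sub_mulVec, smul_mulVec, one_mulVec, dotProduct_sub, dotProduct_smul, smul_eq_mul]
  have hcont : Continuous fun a : Fin p → ℝ => a ⬝ᵥ X *ᵥ a := by fun_prop
  have hcont' : Continuous fun a : Fin p → ℝ => a ⬝ᵥ a := by fun_prop
  have hcompact : IsCompact {a : Fin p → ℝ | a ⬝ᵥ a = 1} := by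
    refine Metric.isCompact_of_isClosed_isBounded (isClosed_eq hcont' continuous_const) ?_
    refine (Metric.isBounded_closedBall (x := 0) (r := 1)).subset fun a ha => ?_
    rw [mem_closedBall_zero_iff, pi_norm_le_iff_of_nonneg zero_le_one]
    intro i
    rw [Real.norm_eq_abs, ← sq_le_one_iff_abs_le_one, sq]
    refine le_trans ?_ (le_of_eq ha)
    exact Finset.single_le_sum (f := fun i => a i * a i) (fun i _ => mul_self_nonneg (a i))
      (Finset.mem_univ i)
  obtain ⟨v, hv, hmax⟩ := hcompact.exists_isMaxOn
    ⟨Pi.single (Classical.arbitrary _) 1, by simp⟩ hcont.continuousOn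
  have hv1 : v ⬝ᵥ v = 1 := hv
  refine ⟨v, hv1, fun γ => ⟨fun h => ?_, fun h => ?_⟩⟩
  · have hv0 : v ≠ 0 := by rintro rfl; simp at hv1
    have := h.dotProduct_mulVec_pos hv0
    rw [star_trivial, hquad, hv1] at this
    linarith
  · refine PosDef.of_dotProduct_mulVec_pos
      ((isHermitian_one.smul (IsSelfAdjoint.all γ)).sub hX) fun a ha => ?_
    rw [star_trivial, hquad]
    have hpos : 0 < a ⬝ᵥ a := lt_of_le_of_ne (dotProduct_self_nonneg_real a)
      fun h0 => ha (dotProduct_self_eq_zero.1 h0.symm)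
    set s := √(a ⬝ᵥ a)
    have hs : s * s = a ⬝ᵥ a := Real.mul_self_sqrt hpos.le
    have hs0 : s ≠ 0 := (Real.sqrt_pos.2 hpos).ne'
    have hm : (s⁻¹ • a) ⬝ᵥ X *ᵥ (s⁻¹ • a) ≤ v ⬝ᵥ X *ᵥ v := hmax (by
      change (s⁻¹ • a) ⬝ᵥ (s⁻¹ • a) = 1
      rw [dotProduct_smul, smul_dotProduct, smul_eq_mul, smul_eq_mul, ← hs]
      field_simp)
    rw [mulVec_smul, dotProduct_smul, smul_dotProduct, smul_eq_mul, smul_eq_mul, ← mul_assoc,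
      ← mul_inv, hs, inv_mul_le_iff₀ hpos] at hm
    nlinarith

end QuadraticForms

end WassersteinShrinkage

namespace WassersteinShrinkage

variable {p : ℕ}

/-! ### Gaussian laws and second moments -/

section Gaussian

/-- A Gaussian law is determined by its mean and covariance. This puts affine images of Gaussian
laws in the normal family without computing their covariance. -/
lemma mem_normalFamily_of_isGaussian (Q : Measure (EuclideanSpace ℝ (Fin p))) [IsGaussian Q] :
    Q ∈ normalFamily p := by
  let b := EuclideanSpace.basisFun (Fin p) ℝ
  let C : Matrix (Fin p) (Fin p) ℝ := Matrix.of fun i j => covarianceBilin Q (b i) (b j)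
  have hquad : ∀ x : Fin p → ℝ, x ⬝ᵥ C *ᵥ x =
      covarianceBilin Q (∑ i, x i • b i) (∑ i, x i • b i) := by
    intro x
    simp only [map_sum, map_smul, _root_.sum_apply,
      _root_.smul_apply, smul_eq_mul, dotProduct, mulVec, C, of_apply, Finset.mul_sum]
    rw [Finset.sum_comm]
    refine Finset.sum_congr rfl fun i _ => Finset.sum_congr rfl fun j _ => ?_
    ring
  have hC : C.PosSemidef := by
    refine PosSemidef.of_dotProduct_mulVec_nonneg ?_ fun x => ?_
    · ext i j
      simp [C, covarianceBilin_comm (b i)]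
    · rw [star_trivial, hquad]
      exact covarianceBilin_self_nonneg _
  refine ⟨∫ x, x ∂Q, C, hC, IsGaussian.ext (by simp) ?_⟩
  rw [← ContinuousLinearMap.toBilinForm_inj]
  refine LinearMap.BilinForm.ext_basis b.toBasis fun i j => ?_
  rw [ContinuousLinearMap.toBilinForm_apply, ContinuousLinearMap.toBilinForm_apply,
    covarianceBilin_multivariateGaussian hC]
  simp [C, b]

lemma norm_sq_eq_dotProduct (v : EuclideanSpace ℝ (Fin p)) : ‖v‖ ^ 2 = v.ofLp ⬝ᵥ v.ofLp := by
  rw [EuclideanSpace.real_norm_sq_eq]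
  simp [dotProduct, sq]

lemma quadForm_sub_eq_sum (A : Matrix (Fin p) (Fin p) ℝ) (ξ m : EuclideanSpace ℝ (Fin p)) :
    quadForm A (ξ - m) = ∑ i, ∑ j, A i j * ((ξ i - m i) * (ξ j - m j)) := by
  simp only [quadForm, dotProduct, mulVec, Finset.mul_sum, PiLp.sub_apply]
  exact Finset.sum_congr rfl fun i _ => Finset.sum_congr rfl fun j _ => by ring

lemma integrable_sub_mul_sub (Q : Measure (EuclideanSpace ℝ (Fin p))) [IsGaussian Q]
    (m : EuclideanSpace ℝ (Fin p)) (i j : Fin p) :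
    Integrable (fun ξ : EuclideanSpace ℝ (Fin p) => (ξ i - m i) * (ξ j - m j)) Q := by
  have hmem : ∀ i : Fin p, MemLp (fun ξ : EuclideanSpace ℝ (Fin p) => ξ i - m i) 2 Q := fun i =>
    ((EuclideanSpace.proj (𝕜 := ℝ) i).comp_memLp' IsGaussian.memLp_two_id).sub (memLp_const _)
  exact (hmem i).integrable_mul (hmem j)

lemma integrable_quadForm_sub (Q : Measure (EuclideanSpace ℝ (Fin p))) [IsGaussian Q]
    (A : Matrix (Fin p) (Fin p) ℝ) (m : EuclideanSpace ℝ (Fin p)) :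
    Integrable (fun ξ => quadForm A (ξ - m)) Q := by
  simp only [quadForm_sub_eq_sum]
  exact integrable_finsetSum _ fun i _ => integrable_finsetSum _ fun j _ =>
    (integrable_sub_mul_sub Q m i j).const_mul _

lemma integral_quadForm_multivariateGaussian {S : Matrix (Fin p) (Fin p) ℝ} (hS : S.PosSemidef)
    (A : Matrix (Fin p) (Fin p) ℝ) (m : EuclideanSpace ℝ (Fin p)) :
    ∫ ξ, quadForm A (ξ - m) ∂(multivariateGaussian m S) = (A * S).trace := by
  have hmean : ∀ i : Fin p, ∫ ξ, ξ i ∂(multivariateGaussian m S) = m i := by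
    intro i
    have := (EuclideanSpace.proj (𝕜 := ℝ) i).integral_comp_id_comm
      (μ := multivariateGaussian m S) IsGaussian.integrable_id
    simpa using this
  have hcov : ∀ i j : Fin p,
      ∫ ξ, (ξ i - m i) * (ξ j - m j) ∂(multivariateGaussian m S) = S i j := by
    intro i j
    rw [← covariance_eval_multivariateGaussian (μ := m) hS i j, covariance, hmean, hmean]
  have hint := integrable_sub_mul_sub (multivariateGaussian m S) m
  simp only [quadForm_sub_eq_sum]
  refine (integral_finsetSum _ fun i _ =>
    integrable_finsetSum _ fun j _ => (hint i j).const_mul _).trans ?_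
  simp only [trace, diag, Matrix.mul_apply]
  refine Finset.sum_congr rfl fun i _ => ?_
  refine (integral_finsetSum _ fun j _ => (hint i j).const_mul _).trans ?_
  refine Finset.sum_congr rfl fun j _ => ?_
  rw [integral_const_mul, hcov, ← hS.isHermitian.apply i j, star_trivial]

end Gaussian

/-! ### Weak duality -/

section WeakDuality

variable {X S : Matrix (Fin p) (Fin p) ℝ} {γ ρ : ℝ}

lemma exists_coupling_of_wassersteinDist_lt {P Q : Measure (EuclideanSpace ℝ (Fin p))}
    [IsProbabilityMeasure P] {c : ℝ} (hc : 0 ≤ c)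
    (h : wassersteinDist P Q < ENNReal.ofReal c) :
    ∃ π : Measure (EuclideanSpace ℝ (Fin p) × EuclideanSpace ℝ (Fin p)),
      IsProbabilityMeasure π ∧ π.map Prod.fst = P ∧ π.map Prod.snd = Q ∧
      Integrable (fun z => ‖z.1 - z.2‖ ^ 2) π ∧ ∫ z, ‖z.1 - z.2‖ ^ 2 ∂π ≤ c ^ 2 := by
  simp only [wassersteinDist, iInf_lt_iff] at h
  obtain ⟨π, ⟨h1, h2⟩, hlt⟩ := h
  have hprob : IsProbabilityMeasure π := by
    have : IsProbabilityMeasure (π.map Prod.fst) := h1 ▸ inferInstance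
    exact Measure.isProbabilityMeasure_of_map Prod.fst
  have hcost : ∫⁻ z, ‖z.1 - z.2‖ₑ ^ 2 ∂π ≤ ENNReal.ofReal (c ^ 2) := by
    have := ENNReal.rpow_le_rpow hlt.le (zero_le_two (α := ℝ))
    rw [← ENNReal.rpow_mul] at this
    norm_num at this
    rwa [ENNReal.ofReal_pow hc]
  have henorm : ∀ z : EuclideanSpace ℝ (Fin p) × EuclideanSpace ℝ (Fin p),
      ‖z.1 - z.2‖ₑ ^ 2 = ENNReal.ofReal (‖z.1 - z.2‖ ^ 2) := fun z => by
    rw [ENNReal.ofReal_pow (norm_nonneg _), ofReal_norm]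
  simp only [henorm] at hcost
  have hint : Integrable (fun z : EuclideanSpace ℝ (Fin p) × EuclideanSpace ℝ (Fin p) =>
      ‖z.1 - z.2‖ ^ 2) π := by
    refine ⟨by fun_prop, ?_⟩
    rw [hasFiniteIntegral_iff_ofReal (Filter.Eventually.of_forall fun z => by positivity)]
    exact hcost.trans_lt ENNReal.ofReal_lt_top
  refine ⟨π, hprob, h1, h2, hint, ?_⟩
  rw [← ofReal_integral_eq_lintegral_ofReal hint
    (Filter.Eventually.of_forall fun z => by positivity)] at hcost
  exact (ENNReal.ofReal_le_ofReal_iff (by positivity)).1 hcost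

lemma integral_quadForm_le_of_mem_ambiguitySet (hS : S.PosSemidef) (hρ : 0 < ρ) (hγ : 0 ≤ γ)
    (hD : (γ • (1 : Matrix (Fin p) (Fin p) ℝ) - X).PosDef)
    {m : EuclideanSpace ℝ (Fin p)} {Q : Measure (EuclideanSpace ℝ (Fin p))}
    (hQ : Q ∈ ambiguitySet ρ m S) :
    ∫ ξ, quadForm X (ξ - m) ∂Q ≤ γ * ρ ^ 2 + (dualMatrix X γ * S).trace := by
  obtain ⟨⟨m', C, -, rfl⟩, hW⟩ := hQ
  -- Attainment of the Wasserstein infimum is not needed: any budget `c > ρ` has a coupling, and `c`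
  -- then decreases to `ρ`.
  have key : ∀ c > ρ, ∫ ξ, quadForm X (ξ - m) ∂(multivariateGaussian m' C) ≤
      γ * c ^ 2 + (dualMatrix X γ * S).trace := by
    intro c hc
    obtain ⟨π, hπ, h1, h2, hint, hcost⟩ := exists_coupling_of_wassersteinDist_lt (hρ.trans hc).le
      (hW.trans_lt ((ENNReal.ofReal_lt_ofReal_iff (hρ.trans hc)).2 hc))
    have hi1 := integrable_quadForm_sub (multivariateGaussian m S) (dualMatrix X γ) m
    have hi2 := integrable_quadForm_sub (multivariateGaussian m' C) X m
    have e1 := integral_quadForm_multivariateGaussian hS (dualMatrix X γ) m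
    rw [← h1] at hi1 e1
    rw [← h2] at hi2 ⊢
    have hm1 := hi1.aestronglyMeasurable
    have hm2 := hi2.aestronglyMeasurable
    rw [integral_map (by fun_prop) hm1] at e1
    rw [integral_map (by fun_prop) hm2]
    rw [integrable_map_measure hm1 (by fun_prop)] at hi1
    rw [integrable_map_measure hm2 (by fun_prop)] at hi2
    calc _ ≤ ∫ z, (γ * ‖z.1 - z.2‖ ^ 2 + quadForm (dualMatrix X γ) (z.1 - m)) ∂π := by
          refine integral_mono hi2 ((hint.const_mul γ).add hi1) fun z => ?_
          have h := dotProduct_mulVec_le_cost_add_dual hD (z.1 - m).ofLp (z.2 - m).ofLp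
          rw [← WithLp.ofLp_sub, sub_sub_sub_cancel_right, ← norm_sq_eq_dotProduct] at h
          exact h
      _ = γ * ∫ z, ‖z.1 - z.2‖ ^ 2 ∂π + (dualMatrix X γ * S).trace := by
          refine (integral_add (hint.const_mul γ) hi1).trans ?_
          rw [integral_const_mul]
          exact congrArg _ e1
      _ ≤ _ := by gcongr
  have hlim : Filter.Tendsto (fun c : ℝ => γ * c ^ 2 + (dualMatrix X γ * S).trace)
      (nhdsWithin ρ (Set.Ioi ρ)) (nhds (γ * ρ ^ 2 + (dualMatrix X γ * S).trace)) :=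
    (Continuous.tendsto (by fun_prop) ρ).mono_left nhdsWithin_le_nhds
  exact ge_of_tendsto hlim (Filter.eventually_of_mem self_mem_nhdsWithin key)

end WeakDuality

end WassersteinShrinkage

namespace WassersteinShrinkage

variable {p : ℕ}

/-- The expected squared displacement `E ‖a - T a‖²` for `a ∼ N(0, S)` and the transport map
`T = γ (γ I - X)⁻¹`. -/
noncomputable def transportCost (S X : Matrix (Fin p) (Fin p) ℝ) (γ : ℝ) : ℝ :=
  (((1 - transportMatrix X γ)ᵀ * (1 - transportMatrix X γ)) * S).trace

/-! ### A nearly worst-case normal law -/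

section StrongDuality

variable {X S : Matrix (Fin p) (Fin p) ℝ} {γ ρ : ℝ}

lemma integral_dotProduct_multivariateGaussian_zero (w : Fin p → ℝ) :
    Integrable (fun a : EuclideanSpace ℝ (Fin p) => w ⬝ᵥ a.ofLp) (multivariateGaussian 0 S) ∧
    ∫ a, w ⬝ᵥ a.ofLp ∂(multivariateGaussian 0 S) = 0 := by
  have hw : ∀ a : EuclideanSpace ℝ (Fin p),
      w ⬝ᵥ a.ofLp = innerSL ℝ (WithLp.toLp 2 w) a := fun a => by
    simp [PiLp.inner_apply, dotProduct, mul_comm]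
  simp only [hw]
  refine ⟨IsGaussian.integrable_dual _ _, ?_⟩
  rw [IsGaussian.integral_dual, integral_id_multivariateGaussian, map_zero]

/-- Terms of odd degree in either independent centred factor integrate to zero. Displacement and
quadratic loss both have this shape. -/
lemma integral_prod_gaussianReal (hS : S.PosSemidef) (A : Matrix (Fin p) (Fin p) ℝ)
    (w₁ w₂ : Fin p → ℝ) (k₀ k₁ k₂ : ℝ) :
    Integrable (fun z : EuclideanSpace ℝ (Fin p) × ℝ => quadForm A z.1 + (w₁ ⬝ᵥ z.1.ofLp) * z.2 +
      w₂ ⬝ᵥ z.1.ofLp + k₁ * z.2 + k₂ * z.2 ^ 2 + k₀)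
      ((multivariateGaussian 0 S).prod (gaussianReal 0 1)) ∧
    ∫ z, (quadForm A z.1 + (w₁ ⬝ᵥ z.1.ofLp) * z.2 + w₂ ⬝ᵥ z.1.ofLp + k₁ * z.2 + k₂ * z.2 ^ 2 + k₀)
      ∂((multivariateGaussian 0 S).prod (gaussianReal 0 1)) = (A * S).trace + k₂ + k₀ := by
  set P := multivariateGaussian (0 : EuclideanSpace ℝ (Fin p)) S
  have hid : Integrable (fun x : ℝ => x) (gaussianReal 0 1) := IsGaussian.integrable_fun_id
  have hsq : Integrable (fun x : ℝ => x ^ 2) (gaussianReal 0 1) :=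
    (IsGaussian.memLp_two_id (μ := gaussianReal 0 1)).integrable_sq
  have hmean : ∫ x, x ∂(gaussianReal 0 1) = 0 := integral_id_gaussianReal
  have hvar : ∫ x, x ^ 2 ∂(gaussianReal 0 1) = 1 := by
    have h := variance_id_gaussianReal (μ := 0) (v := 1)
    rw [variance_eq_integral (by fun_prop)] at h
    simpa [hmean] using h
  have i1 : Integrable (fun z : EuclideanSpace ℝ (Fin p) × ℝ => quadForm A z.1)
      (P.prod (gaussianReal 0 1)) := by
    have := integrable_quadForm_sub P A 0
    simp only [sub_zero] at this
    exact this.comp_fst _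
  have e1 : ∫ z, quadForm A z.1 ∂(P.prod (gaussianReal 0 1)) = (A * S).trace := by
    have := integral_quadForm_multivariateGaussian hS A 0
    simp only [sub_zero] at this
    rw [integral_fun_fst (fun a => quadForm A a), this]
    simp
  obtain ⟨j1, f1⟩ := integral_dotProduct_multivariateGaussian_zero (S := S) w₁
  obtain ⟨j2, f2⟩ := integral_dotProduct_multivariateGaussian_zero (S := S) w₂
  have i2 : Integrable (fun z : EuclideanSpace ℝ (Fin p) × ℝ => (w₁ ⬝ᵥ z.1.ofLp) * z.2)
      (P.prod (gaussianReal 0 1)) := j1.mul_prod hid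
  have e2 : ∫ z, (w₁ ⬝ᵥ z.1.ofLp) * z.2 ∂(P.prod (gaussianReal 0 1)) = 0 := by
    rw [integral_prod_mul (fun a : EuclideanSpace ℝ (Fin p) => w₁ ⬝ᵥ a.ofLp) (fun x : ℝ => x), hmean,
      mul_zero]
  have i3 : Integrable (fun z : EuclideanSpace ℝ (Fin p) × ℝ => w₂ ⬝ᵥ z.1.ofLp)
      (P.prod (gaussianReal 0 1)) := j2.comp_fst _
  have e3 : ∫ z, w₂ ⬝ᵥ z.1.ofLp ∂(P.prod (gaussianReal 0 1)) = 0 := by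
    rw [integral_fun_fst (fun a : EuclideanSpace ℝ (Fin p) => w₂ ⬝ᵥ a.ofLp), f2, smul_zero]
  have i4 : Integrable (fun z : EuclideanSpace ℝ (Fin p) × ℝ => k₁ * z.2)
      (P.prod (gaussianReal 0 1)) := (hid.const_mul k₁).comp_snd _
  have e4 : ∫ z, k₁ * z.2 ∂(P.prod (gaussianReal 0 1)) = 0 := by
    rw [integral_fun_snd (fun x : ℝ => k₁ * x), integral_const_mul, hmean, mul_zero, smul_zero]
  have i5 : Integrable (fun z : EuclideanSpace ℝ (Fin p) × ℝ => k₂ * z.2 ^ 2)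
      (P.prod (gaussianReal 0 1)) := (hsq.const_mul k₂).comp_snd _
  have e5 : ∫ z, k₂ * z.2 ^ 2 ∂(P.prod (gaussianReal 0 1)) = k₂ := by
    rw [integral_fun_snd (fun x : ℝ => k₂ * x ^ 2), integral_const_mul, hvar]
    simp
  have i12 := i1.add i2
  have i13 := i12.add i3
  have i14 := i13.add i4
  have i15 := i14.add i5
  have i16 := i15.add (integrable_const k₀)
  refine ⟨i16, ?_⟩
  refine (integral_add i15 (integrable_const k₀)).trans ?_
  refine (congrArg (· + _) (integral_add i14 i5)).trans ?_
  refine (congrArg (· + _ + _) (integral_add i13 i4)).trans ?_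
  refine (congrArg (· + _ + _ + _) (integral_add i12 i3)).trans ?_
  refine (congrArg (· + _ + _ + _ + _) (integral_add i1 i2)).trans ?_
  simp only [e1, e2, e3, e4, e5, integral_const]
  simp

/-- The law of `m + T a + c g v`, with independent `a ∼ N(0, S)` and `g ∼ N(0, 1)`, lies in the
ambiguity set as soon as its transport cost is at most `ρ²`. -/
lemma exists_mem_ambiguitySet_le_integral (hS : S.PosSemidef) (hX : X.PosSemidef) (hρ : 0 < ρ)
    (hD : (γ • (1 : Matrix (Fin p) (Fin p) ℝ) - X).PosDef) {v : Fin p → ℝ} (hv : v ⬝ᵥ v = 1)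
    (c : ℝ) (hc : transportCost S X γ + c ^ 2 = ρ ^ 2) (m : EuclideanSpace ℝ (Fin p)) :
    ∃ Q ∈ ambiguitySet ρ m S, ∀ μ : EuclideanSpace ℝ (Fin p),
      γ * ρ ^ 2 + (dualMatrix X γ * S).trace - c ^ 2 * (γ - v ⬝ᵥ X *ᵥ v) ≤
        ∫ ξ, quadForm X (ξ - μ) ∂Q := by
  set T := transportMatrix X γ with hT
  let π₀ := (multivariateGaussian (0 : EuclideanSpace ℝ (Fin p)) S).prod (gaussianReal 0 1)
  let L : EuclideanSpace ℝ (Fin p) × ℝ →L[ℝ] EuclideanSpace ℝ (Fin p) :=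
    (toEuclideanCLM (𝕜 := ℝ) T).comp (ContinuousLinearMap.fst ℝ _ _) +
      (ContinuousLinearMap.snd ℝ _ _).smulRight (WithLp.toLp 2 (c • v))
  have hL : ∀ z, (L z).ofLp = T *ᵥ z.1.ofLp + (z.2 * c) • v := fun z => by
    simp [L, smul_smul]
  have hdisp : ∀ z : EuclideanSpace ℝ (Fin p) × ℝ, ‖z.1 - L z‖ ^ 2 =
      quadForm ((1 - T)ᵀ * (1 - T)) z.1 + ((-2 * c) • ((1 - T)ᵀ *ᵥ v)) ⬝ᵥ z.1.ofLp * z.2 +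
        (0 : Fin p → ℝ) ⬝ᵥ z.1.ofLp + 0 * z.2 + c ^ 2 * z.2 ^ 2 + 0 := by
    intro z
    have h1 : (z.1 - L z).ofLp = (1 - T) *ᵥ z.1.ofLp - (z.2 * c) • v := by
      rw [WithLp.ofLp_sub, hL, sub_mulVec, one_mulVec]; abel
    have h2 : quadForm ((1 - T)ᵀ * (1 - T)) z.1 =
        ((1 - T) *ᵥ z.1.ofLp) ⬝ᵥ ((1 - T) *ᵥ z.1.ofLp) := by
      rw [quadForm, ← mulVec_mulVec, dotProduct_mulVec, vecMul_transpose]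
    have h3 : ((1 - T)ᵀ *ᵥ v) ⬝ᵥ z.1.ofLp = v ⬝ᵥ ((1 - T) *ᵥ z.1.ofLp) := by
      rw [mulVec_transpose, ← dotProduct_mulVec]
    rw [norm_sq_eq_dotProduct, h1, h2, smul_dotProduct, h3]
    simp only [dotProduct_sub, sub_dotProduct, dotProduct_smul, smul_dotProduct, smul_eq_mul, hv,
      zero_dotProduct]
    rw [dotProduct_comm _ v]
    ring
  obtain ⟨hint, hcost⟩ := integral_prod_gaussianReal hS ((1 - T)ᵀ * (1 - T))
    ((-2 * c) • ((1 - T)ᵀ *ᵥ v)) 0 0 0 (c ^ 2)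
  simp only [← hdisp] at hint hcost
  have hcost' : ∫ z, ‖z.1 - L z‖ ^ 2 ∂π₀ = ρ ^ 2 := by
    rw [← hc]; simpa [transportCost] using hcost
  let Q := π₀.map fun z => m + L z
  have hQ : IsGaussian Q := by
    have : Q = (π₀.map L).map (m + ·) := by
      rw [Measure.map_map (by fun_prop) (by fun_prop)]; rfl
    rw [this]
    infer_instance
  refine ⟨Q, ⟨mem_normalFamily_of_isGaussian Q, ?_⟩, fun μ => ?_⟩
  -- The coupling pairs `m + a` with `m + L(a, g)`. It need not be optimal, as only its cost `ρ²`
  -- matters.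
  · have hfst : (π₀.map fun z => (m + z.1, m + L z)).map Prod.fst = multivariateGaussian m S := by
      rw [Measure.map_map (by fun_prop) (by fun_prop)]
      have : (Prod.fst ∘ fun z : EuclideanSpace ℝ (Fin p) × ℝ => (m + z.1, m + L z)) =
          (m + ·) ∘ Prod.fst := rfl
      rw [this, ← Measure.map_map (by fun_prop) (by fun_prop),
        measurePreserving_fst.map_eq, multivariateGaussian, multivariateGaussian,
        Measure.map_map (by fun_prop) (by fun_prop)]
      congr 1
      ext z
      simp
    have hsnd : (π₀.map fun z => (m + z.1, m + L z)).map Prod.snd = Q := by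
      rw [Measure.map_map (by fun_prop) (by fun_prop)]
      rfl
    refine (iInf₂_le (π₀.map fun z => (m + z.1, m + L z)) ⟨hfst, hsnd⟩).trans ?_
    rw [lintegral_map (by fun_prop) (by fun_prop)]
    have : ∀ z : EuclideanSpace ℝ (Fin p) × ℝ,
        ‖(m + z.1) - (m + L z)‖ₑ ^ 2 = ENNReal.ofReal (‖z.1 - L z‖ ^ 2) := fun z => by
      rw [add_sub_add_left_eq_sub, ENNReal.ofReal_pow (norm_nonneg _), ofReal_norm]
    simp only [this]
    rw [← ofReal_integral_eq_lintegral_ofReal hint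
      (Filter.Eventually.of_forall fun z => by positivity), hcost',
      ENNReal.ofReal_pow hρ.le, ← ENNReal.rpow_natCast, ← ENNReal.rpow_mul]
    norm_num
  · set d := m - μ with hd
    have hXs : Xᵀ = X := hX.isHermitian
    -- Here `b - Ta = g c v`, so the completed square loses exactly `g²c²(γ - vᵀXv)`; the shift `d`
    -- adds odd terms and `dᵀXd`.
    have hval : ∀ z : EuclideanSpace ℝ (Fin p) × ℝ, quadForm X (m + L z - μ) =
        quadForm (γ • ((1 - T)ᵀ * (1 - T)) + dualMatrix X γ) z.1 +
          (γ • (-2 * c) • ((1 - T)ᵀ *ᵥ v)) ⬝ᵥ z.1.ofLp * z.2 +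
          ((2 : ℝ) • (Tᵀ *ᵥ (X *ᵥ d.ofLp))) ⬝ᵥ z.1.ofLp + (2 * c * (v ⬝ᵥ X *ᵥ d.ofLp)) * z.2 +
          (γ * c ^ 2 - c ^ 2 * (γ - v ⬝ᵥ X *ᵥ v)) * z.2 ^ 2 + quadForm X d := by
      intro z
      have h0 : m + L z - μ = L z + d := by rw [hd]; abel
      have h1 := dotProduct_mulVec_complete_square hD z.1.ofLp (L z).ofLp
      have h2 : (L z).ofLp - T *ᵥ z.1.ofLp = (z.2 * c) • v := by rw [hL]; abel
      have h3 := hdisp z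
      rw [norm_sq_eq_dotProduct, WithLp.ofLp_sub] at h3
      rw [← hT, h2, h3] at h1
      have h4 : quadForm X (L z + d) = (L z).ofLp ⬝ᵥ X *ᵥ (L z).ofLp +
          2 * ((L z).ofLp ⬝ᵥ X *ᵥ d.ofLp) + quadForm X d := by
        have : d.ofLp ⬝ᵥ X *ᵥ (L z).ofLp = (L z).ofLp ⬝ᵥ X *ᵥ d.ofLp := by
          rw [dotProduct_mulVec, ← mulVec_transpose, hXs, dotProduct_comm]
        simp only [quadForm, WithLp.ofLp_add, mulVec_add, dotProduct_add, add_dotProduct, this]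
        ring
      have h5 : (L z).ofLp ⬝ᵥ X *ᵥ d.ofLp =
          (Tᵀ *ᵥ (X *ᵥ d.ofLp)) ⬝ᵥ z.1.ofLp + z.2 * c * (v ⬝ᵥ X *ᵥ d.ofLp) := by
        rw [hL, add_dotProduct, smul_dotProduct, smul_eq_mul, mulVec_transpose,
          ← dotProduct_mulVec, dotProduct_comm (X *ᵥ d.ofLp)]
      have h6 : quadForm (γ • ((1 - T)ᵀ * (1 - T)) + dualMatrix X γ) z.1 =
          γ * quadForm ((1 - T)ᵀ * (1 - T)) z.1 + z.1.ofLp ⬝ᵥ dualMatrix X γ *ᵥ z.1.ofLp := by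
        simp only [quadForm, add_mulVec, smul_mulVec, dotProduct_add, dotProduct_smul, smul_eq_mul]
      rw [h0, h4, h1, h5, h6]
      simp only [sub_mulVec, smul_mulVec, one_mulVec, mulVec_smul, dotProduct_sub, dotProduct_smul,
        smul_dotProduct, smul_eq_mul, hv, zero_dotProduct]
      ring
    have hmeas : AEStronglyMeasurable (fun ξ => quadForm X (ξ - μ)) Q :=
      (integrable_quadForm_sub Q X μ).aestronglyMeasurable
    rw [integral_map (by fun_prop) hmeas]
    simp only [hval]
    rw [(integral_prod_gaussianReal hS _ _ _ _ _ _).2, add_mul, trace_add, smul_mul, trace_smul,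
      smul_eq_mul, ← transportCost.eq_def]
    have h7 := hX.dotProduct_mulVec_nonneg d.ofLp
    rw [star_trivial] at h7
    have h8 : transportCost S X γ = ρ ^ 2 - c ^ 2 := by rw [← hc]; ring
    rw [h8, quadForm]
    linarith

end StrongDuality

end WassersteinShrinkage

namespace WassersteinShrinkage

variable {p : ℕ}

/-! ### Choice of the multiplier and strong duality -/

section Duality

variable {X S : Matrix (Fin p) (Fin p) ℝ} {γ ρ : ℝ}

lemma continuousAt_matrix_inv {A : Matrix (Fin p) (Fin p) ℝ} (hA : A.det ≠ 0) :
    ContinuousAt (fun B : Matrix (Fin p) (Fin p) ℝ => B⁻¹) A := by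
  simp only [Matrix.inv_def, Ring.inverse_eq_inv']
  have h1 : ContinuousAt (fun B : Matrix (Fin p) (Fin p) ℝ => B.det) A :=
    (continuous_id.matrix_det).continuousAt
  exact (h1.inv₀ hA).smul (continuous_id.matrix_adjugate).continuousAt

lemma continuous_displacement_trace (S : Matrix (Fin p) (Fin p) ℝ) :
    Continuous fun T : Matrix (Fin p) (Fin p) ℝ => (((1 - T)ᵀ * (1 - T)) * S).trace := by
  fun_prop

lemma continuousAt_transportCost (S : Matrix (Fin p) (Fin p) ℝ)
    (hD : (γ • (1 : Matrix (Fin p) (Fin p) ℝ) - X).PosDef) :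
    ContinuousAt (transportCost S X) γ := by
  have h1 : ContinuousAt (fun γ : ℝ => γ • (1 : Matrix (Fin p) (Fin p) ℝ) - X) γ := by fun_prop
  have h2 := ContinuousAt.comp (f := fun γ : ℝ => γ • (1 : Matrix (Fin p) (Fin p) ℝ) - X)
    (continuousAt_matrix_inv hD.det_pos.ne') h1
  exact (continuous_displacement_trace S).continuousAt.comp (continuousAt_id.smul h2)

/-- For large `γ`, `T = (I - γ⁻¹X)⁻¹` tends to `I`, so nothing moves in the limit. -/
lemma tendsto_transportCost_atTop (S X : Matrix (Fin p) (Fin p) ℝ) (l : ℝ)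
    (hl : ∀ γ > l, (γ • (1 : Matrix (Fin p) (Fin p) ℝ) - X).PosDef) :
    Filter.Tendsto (transportCost S X) Filter.atTop (nhds 0) := by
  have h1 : Filter.Tendsto (fun γ : ℝ => (1 : Matrix (Fin p) (Fin p) ℝ) - γ⁻¹ • X) Filter.atTop
      (nhds 1) := by
    have := (tendsto_inv_atTop_zero (𝕜 := ℝ)).smul_const X
    simpa using this.const_sub 1
  have h2 := (continuousAt_matrix_inv (A := (1 : Matrix (Fin p) (Fin p) ℝ)) (by simp)).tendsto.comp
    h1
  have h3 := (continuous_displacement_trace S).continuousAt.tendsto.comp h2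
  simp only [inv_one, sub_self, Matrix.transpose_zero, Matrix.zero_mul, trace_zero] at h3
  refine h3.congr' ?_
  filter_upwards [Filter.eventually_gt_atTop l, Filter.eventually_gt_atTop 0] with γ hγ hγ0
  have : ((1 : Matrix (Fin p) (Fin p) ℝ) - γ⁻¹ • X)⁻¹ = transportMatrix X γ := by
    refine inv_eq_right_inv ?_
    have hD := hl γ hγ
    have h4 : (1 : Matrix (Fin p) (Fin p) ℝ) - γ⁻¹ • X = γ⁻¹ • (γ • 1 - X) := by
      rw [smul_sub, smul_smul, inv_mul_cancel₀ hγ0.ne', one_smul]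
    rw [h4, transportMatrix, smul_mul_smul_comm, inv_mul_cancel₀ hγ0.ne', one_smul,
      mul_nonsing_inv _ ((isUnit_iff_isUnit_det _).1 hD.isUnit)]
  simp only [Function.comp_apply, this, transportCost]

lemma transportCost_nonneg (hS : S.PosSemidef) (X : Matrix (Fin p) (Fin p) ℝ) (γ : ℝ) :
    0 ≤ transportCost S X γ := by
  have := trace_mul_mono (A := 0) (B := (1 - transportMatrix X γ)ᵀ * (1 - transportMatrix X γ)) hS
    fun a => by
      rw [zero_mulVec, dotProduct_zero, ← mulVec_mulVec, dotProduct_mulVec, vecMul_transpose]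
      exact dotProduct_self_nonneg_real _
  simpa [transportCost] using this

/-- Approximate complementary slackness for the multiplier `γ`. -/
lemma exists_multiplier (hS : S.PosSemidef) (hρ : 0 < ρ) {l : ℝ}
    (hl : ∀ γ > l, (γ • (1 : Matrix (Fin p) (Fin p) ℝ) - X).PosDef) {ε : ℝ} (hε : 0 < ε) :
    ∃ γ > l, transportCost S X γ ≤ ρ ^ 2 ∧ (ρ ^ 2 - transportCost S X γ) * (γ - l) ≤ ε := by
  have hρ2 : 0 < ρ ^ 2 := by positivity
  -- At `γ₀` even an unspent budget costs at most `ρ²(γ₀ - l) = ε`. If `γ₀` overspends, some larger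
  -- `γ` spends exactly `ρ²`.
  set γ₀ := l + ε / ρ ^ 2 with hγ₀
  have hpos : 0 < ε / ρ ^ 2 := by positivity
  have hlt : l < γ₀ := by linarith
  by_cases hle : transportCost S X γ₀ ≤ ρ ^ 2
  · refine ⟨γ₀, hlt, hle, ?_⟩
    have h1 := transportCost_nonneg hS X γ₀
    calc (ρ ^ 2 - transportCost S X γ₀) * (γ₀ - l) ≤ ρ ^ 2 * (γ₀ - l) := by
          apply mul_le_mul_of_nonneg_right <;> linarith
      _ = ε := by rw [hγ₀]; field_simp; ring
  · push Not at hle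
    obtain ⟨γ₁, h1, h2⟩ := (((tendsto_transportCost_atTop S X l hl).eventually_lt_const hρ2).and
      (Filter.eventually_ge_atTop γ₀)).exists
    have hcont : ContinuousOn (transportCost S X) (Set.Icc γ₀ γ₁) := fun γ hγ =>
      (continuousAt_transportCost S (hl γ (hlt.trans_le hγ.1))).continuousWithinAt
    obtain ⟨γ, hγ, he⟩ := intermediate_value_Icc' h2 hcont ⟨h1.le, hle.le⟩
    refine ⟨γ, hlt.trans_le hγ.1, he.le, ?_⟩
    rw [he, sub_self, zero_mul]
    exact hε.le

/-- False for `p = 0`: every real `γ` is then feasible and the objective `γρ²` is unbounded below.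
-/
lemma multiplier_pos (hp : 1 ≤ p) (hX : X.PosDef)
    (hD : (γ • (1 : Matrix (Fin p) (Fin p) ℝ) - X).PosDef) : 0 < γ := by
  have h1 := hX.diag_pos (i := ⟨0, hp⟩)
  have h2 := hD.diag_pos (i := ⟨0, hp⟩)
  simp at h2
  linarith

lemma convexObjective_eq (S : Matrix (Fin p) (Fin p) ℝ)
    (hD : (γ • (1 : Matrix (Fin p) (Fin p) ℝ) - X).PosDef) :
    convexObjective ρ S X γ =
      -Real.log X.det + (γ * ρ ^ 2 + (dualMatrix X γ * S).trace) := by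
  rw [convexObjective, matrixInner, transpose_inv_smul_one_sub hD, dualMatrix, Matrix.sub_mul,
    smul_mul, smul_mul, Matrix.one_mul, trace_sub, trace_smul, trace_smul, smul_eq_mul, smul_eq_mul]
  ring

lemma droObjective_le_convexObjective (hp : 1 ≤ p) (hS : S.PosSemidef) (hρ : 0 < ρ)
    (hX : X.PosDef) (hD : (γ • (1 : Matrix (Fin p) (Fin p) ℝ) - X).PosDef)
    (m : EuclideanSpace ℝ (Fin p)) :
    droObjective ρ m S m X ≤ (convexObjective ρ S X γ : EReal) := by
  rw [convexObjective_eq S hD, EReal.coe_add]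
  refine add_le_add_right (iSup₂_le fun Q hQ => ?_) _
  exact EReal.coe_le_coe_iff.2
    (integral_quadForm_le_of_mem_ambiguitySet hS hρ (multiplier_pos hp hX hD).le hD hQ)

lemma iInf_convexObjective_le_droObjective (hp : 1 ≤ p) (hS : S.PosSemidef) (hρ : 0 < ρ)
    (hX : X.PosDef) (m μ : EuclideanSpace ℝ (Fin p)) :
    ⨅ (γ : ℝ) (_ : (γ • (1 : Matrix (Fin p) (Fin p) ℝ) - X).PosDef),
      (convexObjective ρ S X γ : EReal) ≤ droObjective ρ m S μ X := by
  obtain ⟨v, hv, hiff⟩ := exists_unit_maximizer hp hX.isHermitian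
  by_contra! hlt
  -- Two reals inside the supposed gap give the tolerance `ε = s - r` for the multiplier.
  obtain ⟨r, hr, hr'⟩ := EReal.lt_iff_exists_real_btwn.1 hlt
  obtain ⟨s, hs, hs'⟩ := EReal.lt_iff_exists_real_btwn.1 hr'
  have hrs : r < s := EReal.coe_lt_coe_iff.1 hs
  obtain ⟨γ, hγ, hle, hslack⟩ := exists_multiplier hS hρ (fun γ hγ => (hiff γ).2 hγ)
    (sub_pos.2 hrs)
  have hD := (hiff γ).2 hγ
  obtain ⟨Q, hQ, hval⟩ := exists_mem_ambiguitySet_le_integral hS hX.posSemidef hρ hD hv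
    (√(ρ ^ 2 - transportCost S X γ)) (by rw [Real.sq_sqrt (sub_nonneg.2 hle)]; ring) m
  have h1 := hval μ
  rw [Real.sq_sqrt (sub_nonneg.2 hle)] at h1
  have h2 : s < convexObjective ρ S X γ :=
    EReal.coe_lt_coe_iff.1 (hs'.trans_le (iInf₂_le γ hD))
  have h3 : ((-Real.log X.det + ∫ ξ, quadForm X (ξ - μ) ∂Q : ℝ) : EReal) ≤
      droObjective ρ m S μ X := by
    rw [EReal.coe_add]
    exact add_le_add_right (le_iSup₂ (f := fun (Q : Measure (EuclideanSpace ℝ (Fin p)))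
      (_ : Q ∈ ambiguitySet ρ m S) => ((∫ ξ, quadForm X (ξ - μ) ∂Q : ℝ) : EReal)) Q hQ) _
  have h4 := EReal.coe_lt_coe_iff.1 (h3.trans_lt hr)
  rw [convexObjective_eq S hD] at h2
  linarith

end Duality

/-! ### Equality of the three values and the Schur complement -/

section Reformulations

variable {𝒳 : Set (Matrix (Fin p) (Fin p) ℝ)} {X S : Matrix (Fin p) (Fin p) ℝ} {γ ρ : ℝ}

lemma iInf_droObjective_eq (hp : 1 ≤ p) (h𝒳 : ∀ X ∈ 𝒳, X.PosDef) (hρ : 0 < ρ)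
    (hS : S.PosSemidef) (hX : X ∈ 𝒳) (m : EuclideanSpace ℝ (Fin p)) :
    droObjective ρ m S m X = ⨅ μ, droObjective ρ m S μ X ∧
    ⨅ μ, droObjective ρ m S μ X =
      ⨅ (γ : ℝ) (_ : ConvexFeasible 𝒳 X γ), (convexObjective ρ S X γ : EReal) := by
  have h1 : droObjective ρ m S m X ≤
      ⨅ (γ : ℝ) (_ : ConvexFeasible 𝒳 X γ), (convexObjective ρ S X γ : EReal) :=
    le_iInf₂ fun γ hγ => droObjective_le_convexObjective hp hS hρ (h𝒳 X hX) hγ.1 m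
  have h2 : ⨅ (γ : ℝ) (_ : ConvexFeasible 𝒳 X γ), (convexObjective ρ S X γ : EReal) ≤
      ⨅ μ, droObjective ρ m S μ X := le_iInf fun μ =>
    (le_iInf₂ fun γ hγ => iInf₂_le γ ⟨hγ, h𝒳 X hX, hX⟩).trans
      (iInf_convexObjective_le_droObjective hp hS hρ (h𝒳 X hX) m μ)
  have h3 : ⨅ μ, droObjective ρ m S μ X ≤ droObjective ρ m S m X := iInf_le _ m
  exact ⟨le_antisymm (h1.trans h2) h3, le_antisymm (h3.trans h1) h2⟩

lemma droValue_eq_convexValue (hp : 1 ≤ p) (h𝒳 : ∀ X ∈ 𝒳, X.PosDef) (hρ : 0 < ρ)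
    (hS : S.PosSemidef) (m : EuclideanSpace ℝ (Fin p)) :
    droValue 𝒳 ρ m S = convexValue 𝒳 ρ S := by
  refine le_antisymm ?_ ?_
  · refine le_iInf fun X => le_iInf₂ fun γ hγ => ?_
    exact (iInf_le_of_le m (iInf₂_le X hγ.2.2)).trans
      (droObjective_le_convexObjective hp hS hρ hγ.2.1 hγ.1 m)
  · refine le_iInf fun μ => le_iInf₂ fun X hX => (iInf_le _ X).trans ?_
    rw [← (iInf_droObjective_eq hp h𝒳 hρ hS hX m).2]
    exact iInf_le _ μ

lemma fromBlocks_posSemidef_iff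
    (hD : (γ • (1 : Matrix (Fin p) (Fin p) ℝ) - X).PosDef) (Y : Matrix (Fin p) (Fin p) ℝ) :
    (Matrix.fromBlocks Y (γ • CFC.sqrt S) (γ • CFC.sqrt S)
      (γ • (1 : Matrix (Fin p) (Fin p) ℝ) - X)).PosSemidef ↔
    (Y - (γ • CFC.sqrt S) * (γ • (1 : Matrix (Fin p) (Fin p) ℝ) - X)⁻¹ *
      (γ • CFC.sqrt S)).PosSemidef := by
  have hs : (γ • CFC.sqrt S)ᴴ = γ • CFC.sqrt S := by
    rw [conjTranspose_smul, star_trivial]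
    exact congrArg _ (CFC.sqrt_nonneg S).posSemidef.isHermitian
  let := hD.isUnit.invertible
  have := PosDef.fromBlocks₂₂ Y (γ • CFC.sqrt S) hD
  rwa [hs] at this

lemma trace_schur_term (hS : S.PosSemidef)
    (hD : (γ • (1 : Matrix (Fin p) (Fin p) ℝ) - X).PosDef) :
    ((γ • CFC.sqrt S) * (γ • (1 : Matrix (Fin p) (Fin p) ℝ) - X)⁻¹ * (γ • CFC.sqrt S)).trace =
      γ ^ 2 * matrixInner (γ • (1 : Matrix (Fin p) (Fin p) ℝ) - X)⁻¹ S := by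
  rw [matrixInner, transpose_inv_smul_one_sub hD, smul_mul, smul_mul,
    Matrix.mul_smul, smul_smul, trace_smul, smul_eq_mul, Matrix.mul_assoc, trace_mul_comm, Matrix.mul_assoc,
    CFC.sqrt_mul_sqrt_self S hS.nonneg, sq]

lemma SdpFeasible.convexFeasible {Y : Matrix (Fin p) (Fin p) ℝ} (h : SdpFeasible 𝒳 S X Y γ) :
    ConvexFeasible 𝒳 X γ := ⟨h.2.1, h.2.2.1, h.2.2.2.2⟩

lemma convexObjective_le_sdpObjective (hS : S.PosSemidef) {Y : Matrix (Fin p) (Fin p) ℝ}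
    (h : SdpFeasible 𝒳 S X Y γ) : convexObjective ρ S X γ ≤ sdpObjective ρ S X Y γ := by
  have h1 := ((fromBlocks_posSemidef_iff h.2.1 Y).1 h.1).trace_nonneg
  rw [trace_sub, trace_schur_term hS h.2.1] at h1
  rw [convexObjective, sdpObjective]
  linarith

/-- The smallest admissible `Y` makes the Schur complement of `γI - X` vanish. -/
lemma exists_sdpFeasible (hS : S.PosSemidef) (h : ConvexFeasible 𝒳 X γ) :
    ∃ Y, SdpFeasible 𝒳 S X Y γ ∧ sdpObjective ρ S X Y γ = convexObjective ρ S X γ := by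
  refine ⟨(γ • CFC.sqrt S) * (γ • (1 : Matrix (Fin p) (Fin p) ℝ) - X)⁻¹ * (γ • CFC.sqrt S),
    ⟨(fromBlocks_posSemidef_iff h.1 _).2 ?_, h.1, h.2.1, ?_, h.2.2⟩, ?_⟩
  · rw [sub_self]; exact PosSemidef.zero
  · have hs : (γ • CFC.sqrt S)ᴴ = γ • CFC.sqrt S := by
      rw [conjTranspose_smul, star_trivial]
      exact congrArg _ (CFC.sqrt_nonneg S).posSemidef.isHermitian
    have := h.1.inv.posSemidef.mul_mul_conjTranspose_same (γ • CFC.sqrt S)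
    rwa [hs] at this
  · rw [sdpObjective, trace_schur_term hS h.1, convexObjective]

lemma iInf_sdpObjective_eq (hS : S.PosSemidef) (X : Matrix (Fin p) (Fin p) ℝ) :
    ⨅ (Y : Matrix (Fin p) (Fin p) ℝ) (γ : ℝ) (_ : SdpFeasible 𝒳 S X Y γ),
      (sdpObjective ρ S X Y γ : EReal) =
    ⨅ (γ : ℝ) (_ : ConvexFeasible 𝒳 X γ), (convexObjective ρ S X γ : EReal) := by
  refine le_antisymm (le_iInf₂ fun γ hγ => ?_) (le_iInf fun Y => le_iInf₂ fun γ hγ => ?_)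
  · obtain ⟨Y, hY, he⟩ := exists_sdpFeasible (ρ := ρ) hS hγ
    rw [← he]
    exact iInf_le_of_le Y (iInf₂_le γ hY)
  · exact (iInf₂_le γ hγ.convexFeasible).trans
      (EReal.coe_le_coe_iff.2 (convexObjective_le_sdpObjective hS hγ))

lemma sdpValue_eq_convexValue (hS : S.PosSemidef) : sdpValue 𝒳 ρ S = convexValue 𝒳 ρ S :=
  iInf_congr fun X => iInf_sdpObjective_eq hS X

end Reformulations

/-! ### Coercivity, finiteness and continuity -/

section Continuity

variable {𝒳 : Set (Matrix (Fin p) (Fin p) ℝ)} {X S : Matrix (Fin p) (Fin p) ℝ} {γ ρ : ℝ}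

/-- Sum `log(tλ) ≤ tλ - 1` over the eigenvalues; the slope `t` stays free. -/
lemma log_det_le (hX : X.PosDef) {t : ℝ} (ht : 0 < t) :
    Real.log X.det ≤ t * X.trace - p * (1 + Real.log t) := by
  have hdet : X.det = ∏ i, hX.isHermitian.eigenvalues i := by
    simpa using hX.isHermitian.det_eq_prod_eigenvalues
  have htr : X.trace = ∑ i, hX.isHermitian.eigenvalues i := by
    simpa using hX.isHermitian.trace_eq_sum_eigenvalues
  have hp : (p : ℝ) * (1 + Real.log t) = ∑ _i : Fin p, (1 + Real.log t) := by simp [mul_add]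
  rw [hdet, htr, Real.log_prod fun i _ => (hX.eigenvalues_pos i).ne', Finset.mul_sum, hp,
    ← Finset.sum_sub_distrib]
  refine Finset.sum_le_sum fun i _ => ?_
  have h := Real.log_le_sub_one_of_pos (mul_pos ht (hX.eigenvalues_pos i))
  rw [Real.log_mul ht.ne' (hX.eigenvalues_pos i).ne'] at h
  linarith

lemma trace_le_of_posDef (hD : (γ • (1 : Matrix (Fin p) (Fin p) ℝ) - X).PosDef) :
    X.trace ≤ p * γ := by
  have h := hD.posSemidef.trace_nonneg
  rw [trace_sub, trace_smul, trace_one, Fintype.card_fin, smul_eq_mul] at h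
  linarith

/-- The objective of the convex program is coercive in `γ`, uniformly in `X` and `S`. -/
lemma exists_coercive_bound (hp : 1 ≤ p) (hρ : 0 < ρ) :
    ∃ K : ℝ, ∀ (S X : Matrix (Fin p) (Fin p) ℝ) (γ : ℝ), S.PosSemidef → X.PosDef →
      (γ • (1 : Matrix (Fin p) (Fin p) ℝ) - X).PosDef →
      γ * (ρ ^ 2 / 2) + K ≤ convexObjective ρ S X γ := by
  have hp' : (0 : ℝ) < p := by exact_mod_cast hp
  -- With this slope and `Tr X ≤ pγ`, the log-determinant absorbs at most half of `γρ²`, up to a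
  -- constant.
  have ht : 0 < ρ ^ 2 / (2 * p) := by positivity
  refine ⟨p * (1 + Real.log (ρ ^ 2 / (2 * p))), fun S X γ hS hX hD => ?_⟩
  have h1 := log_det_le hX ht
  have h2 : ρ ^ 2 / (2 * p) * X.trace ≤ ρ ^ 2 / (2 * p) * (p * γ) :=
    mul_le_mul_of_nonneg_left (trace_le_of_posDef hD) ht.le
  have h3 : ρ ^ 2 / (2 * p) * (p * γ) = γ * (ρ ^ 2 / 2) := by field_simp
  have h4 := trace_mul_mono (A := 0) (B := dualMatrix X γ) hS fun a => by
    rw [zero_mulVec, dotProduct_zero]; exact dual_nonneg hX.posSemidef hD a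
  rw [Matrix.zero_mul, trace_zero] at h4
  rw [convexObjective_eq S hD]
  linarith

lemma convexValue_ne_bot (hp : 1 ≤ p) (hρ : 0 < ρ) (hS : S.PosSemidef) :
    convexValue 𝒳 ρ S ≠ ⊥ := by
  obtain ⟨K, hK⟩ := exists_coercive_bound hp hρ
  refine ne_of_gt ((EReal.bot_lt_coe K).trans_le ?_)
  refine le_iInf fun X => le_iInf₂ fun γ hγ => EReal.coe_le_coe_iff.2 ?_
  have := hK S X γ hS hγ.2.1 hγ.1
  have h0 := multiplier_pos hp hγ.2.1 hγ.1
  have : 0 ≤ γ * (ρ ^ 2 / 2) := by positivity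
  linarith

lemma convexValue_ne_top (hp : 1 ≤ p) (h𝒳 : ∀ X ∈ 𝒳, X.PosDef) (hne : 𝒳.Nonempty) :
    convexValue 𝒳 ρ S ≠ ⊤ := by
  obtain ⟨X, hX⟩ := hne
  obtain ⟨v, -, hiff⟩ := exists_unit_maximizer hp (h𝒳 X hX).isHermitian
  have hD := (hiff (v ⬝ᵥ X *ᵥ v + 1)).2 (lt_add_one _)
  refine ne_of_lt (lt_of_le_of_lt (iInf_le_of_le X (iInf₂_le _ ⟨hD, h𝒳 X hX, hX⟩))
    (EReal.coe_lt_top _))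

/-- Increasing the multiplier makes the objective Lipschitz in the covariance matrix, uniformly
in `X`. -/
lemma convexObjective_add_le (hX : X.PosDef) {S' : Matrix (Fin p) (Fin p) ℝ} (hS' : S'.PosSemidef)
    (hD : (γ • (1 : Matrix (Fin p) (Fin p) ℝ) - X).PosDef) {δ : ℝ} (hδ : 0 < δ) :
    convexObjective ρ S X (γ + δ) ≤ convexObjective ρ S' X γ + δ * ρ ^ 2 +
      γ * (γ + δ) / δ * ∑ i, ∑ j, |S i j - S' i j| := by
  have hD' := posDef_smul_one_sub_of_le hD (le_add_of_nonneg_right hδ.le)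
  rw [convexObjective_eq S hD', convexObjective_eq S' hD]
  -- Raising `γ` comes before exchanging `S'` for `S`: at `γ` itself `(γI - X)⁻¹` has no bound
  -- uniform in `X`, whereas at `γ + δ` the dual matrix does.
  have h1 := trace_mul_mono hS' (dual_antitone hD (le_add_of_nonneg_right hδ.le))
  have h2 := (le_abs_self _).trans (abs_trace_mul_le (B := S - S')
    (abs_apply_le_of_quadratic_bound (dualMatrix_transpose hD') (dual_nonneg hX.posSemidef hD')
      (dual_add_le hδ hD)))
  rw [Matrix.mul_sub, trace_sub] at h2
  simp only [Matrix.sub_apply] at h2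
  linarith

/-- Upper semicontinuity is automatic for an infimum of continuous functions. For lower
semicontinuity, coercivity disposes of large `γ`, and the uniform Lipschitz estimate treats the
others. -/
lemma continuousOn_convexValue (hp : 1 ≤ p) (hρ : 0 < ρ) :
    ContinuousOn (convexValue 𝒳 ρ) {S | S.PosSemidef} := by
  intro S hS
  refine tendsto_order.2 ⟨fun a ha => ?_, fun a ha => ?_⟩
  · obtain ⟨r, har, hr⟩ := EReal.lt_iff_exists_real_btwn.1 ha
    obtain ⟨s, hrs, hs⟩ := EReal.lt_iff_exists_real_btwn.1 hr
    have hrs : r < s := EReal.coe_lt_coe_iff.1 hrs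
    obtain ⟨K, hK⟩ := exists_coercive_bound hp hρ
    have hρ2 : 0 < ρ ^ 2 := by positivity
    obtain ⟨Γ, hΓ0, hΓ⟩ : ∃ Γ : ℝ, 0 < Γ ∧ ∀ γ ≥ Γ, r ≤ γ * (ρ ^ 2 / 2) + K := by
      refine ⟨max 1 ((r - K) / (ρ ^ 2 / 2)), by positivity, fun γ hγ => ?_⟩
      have := (div_le_iff₀ (by positivity : 0 < ρ ^ 2 / 2)).1 ((le_max_right _ _).trans hγ)
      linarith
    -- Half of the gap `s - r` pays for `δρ²`; the other half bounds the effect of replacing `S'` by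
    -- `S`.
    set δ := (s - r) / (2 * ρ ^ 2) with hδ
    have hδ0 : 0 < δ := div_pos (sub_pos.2 hrs) (by positivity)
    have hδρ : δ * ρ ^ 2 = (s - r) / 2 := by rw [hδ]; field_simp
    have hcont : Continuous fun S' : Matrix (Fin p) (Fin p) ℝ =>
        Γ * (Γ + δ) / δ * ∑ i, ∑ j, |S i j - S' i j| := by fun_prop
    have hev := (hcont.tendsto S).eventually_lt_const
      (show _ < (s - r) / 2 by simpa using hrs)
    filter_upwards [nhdsWithin_le_nhds hev, self_mem_nhdsWithin] with S' h1 hS'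
    refine har.trans_le (le_iInf fun X => le_iInf₂ fun γ hγ => EReal.coe_le_coe_iff.2 ?_)
    obtain ⟨hD, hX, hX𝒳⟩ := hγ
    rcases le_or_gt Γ γ with hge | hlt
    · exact (hΓ γ hge).trans (hK S' X γ hS' hX hD)
    · have hγ0 := multiplier_pos hp hX hD
      have h2 := convexObjective_add_le (S := S) (ρ := ρ) hX hS' hD hδ0
      have h3 : s < convexObjective ρ S X (γ + δ) := EReal.coe_lt_coe_iff.1 (hs.trans_le
        (iInf_le_of_le X (iInf₂_le _ ⟨posDef_smul_one_sub_of_le hD (by linarith), hX, hX𝒳⟩)))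
      have h4 : γ * (γ + δ) / δ * ∑ i, ∑ j, |S i j - S' i j| ≤
          Γ * (Γ + δ) / δ * ∑ i, ∑ j, |S i j - S' i j| := by gcongr
      linarith
  · simp only [convexValue, iInf_lt_iff] at ha
    obtain ⟨X, γ, hγ, hlt⟩ := ha
    have hcont : Continuous fun S' : Matrix (Fin p) (Fin p) ℝ =>
        ((convexObjective ρ S' X γ : ℝ) : EReal) := by
      refine continuous_coe_real_ereal.comp ?_
      unfold convexObjective matrixInner
      fun_prop
    filter_upwards [nhdsWithin_le_nhds ((hcont.tendsto S).eventually_lt_const hlt)] with S' h1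
    exact (iInf_le_of_le X (iInf₂_le γ hγ)).trans_lt h1

end Continuity

end WassersteinShrinkage

theorem theorem2p9 (p : ℕ) (hp : 1 ≤ p) (𝒳 : Set (Matrix (Fin p) (Fin p) ℝ))
    (h𝒳 : ∀ X ∈ 𝒳, X.PosDef) (ρ : ℝ) (hρ : 0 < ρ) :
    -- equality of the optimal values of the three problems
    (∀ (muHat : EuclideanSpace ℝ (Fin p)) (S : Matrix (Fin p) (Fin p) ℝ), S.PosSemidef →
      WassersteinShrinkage.droValue 𝒳 ρ muHat S = WassersteinShrinkage.convexValue 𝒳 ρ S ∧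
      WassersteinShrinkage.droValue 𝒳 ρ muHat S = WassersteinShrinkage.sdpValue 𝒳 ρ S) ∧
    -- equality of the three objectives as functions of `X`, after the other variables have been
    -- eliminated by minimization; in the robust problem, `μ = muHat` is optimal for every `X`
    (∀ (muHat : EuclideanSpace ℝ (Fin p)) (S : Matrix (Fin p) (Fin p) ℝ), S.PosSemidef →
      ∀ X ∈ 𝒳,
        WassersteinShrinkage.droObjective ρ muHat S muHat X =
          ⨅ μ : EuclideanSpace ℝ (Fin p), WassersteinShrinkage.droObjective ρ muHat S μ X ∧
        (⨅ μ : EuclideanSpace ℝ (Fin p), WassersteinShrinkage.droObjective ρ muHat S μ X) =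
          ⨅ (γ : ℝ) (_ : WassersteinShrinkage.ConvexFeasible 𝒳 X γ),
            ((WassersteinShrinkage.convexObjective ρ S X γ : ℝ) : EReal) ∧
        (⨅ μ : EuclideanSpace ℝ (Fin p), WassersteinShrinkage.droObjective ρ muHat S μ X) =
          ⨅ (Y : Matrix (Fin p) (Fin p) ℝ) (γ : ℝ)
            (_ : WassersteinShrinkage.SdpFeasible 𝒳 S X Y γ),
            ((WassersteinShrinkage.sdpObjective ρ S X Y γ : ℝ) : EReal)) ∧
    -- the optimal value is finite as soon as some `X` is admissible
    (𝒳.Nonempty → ∀ (muHat : EuclideanSpace ℝ (Fin p)) (S : Matrix (Fin p) (Fin p) ℝ),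
      S.PosSemidef →
        WassersteinShrinkage.droValue 𝒳 ρ muHat S ≠ ⊥ ∧
        WassersteinShrinkage.droValue 𝒳 ρ muHat S ≠ ⊤) ∧
    -- the optimal value is constant in the sample mean
    (∀ S : Matrix (Fin p) (Fin p) ℝ, S.PosSemidef →
      ∀ muHat₁ muHat₂ : EuclideanSpace ℝ (Fin p),
        WassersteinShrinkage.droValue 𝒳 ρ muHat₁ S =
          WassersteinShrinkage.droValue 𝒳 ρ muHat₂ S) ∧
    -- the optimal value is continuous in the sample covariance matrix
    (∀ muHat : EuclideanSpace ℝ (Fin p),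
      ContinuousOn (fun S : Matrix (Fin p) (Fin p) ℝ =>
        WassersteinShrinkage.droValue 𝒳 ρ muHat S) {S | S.PosSemidef}) := by
  have heq := fun (m : EuclideanSpace ℝ (Fin p)) (S : Matrix (Fin p) (Fin p) ℝ)
    (hS : S.PosSemidef) => WassersteinShrinkage.droValue_eq_convexValue hp h𝒳 hρ hS m
  refine ⟨fun m S hS => ⟨heq m S hS, ?_⟩, fun m S hS X hX => ?_, fun hne m S hS => ?_,
    fun S hS m₁ m₂ => ?_, fun m => ?_⟩
  · rw [heq m S hS, WassersteinShrinkage.sdpValue_eq_convexValue hS]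
  · obtain ⟨h1, h2⟩ := WassersteinShrinkage.iInf_droObjective_eq hp h𝒳 hρ hS hX m
    exact ⟨h1, h2, h2.trans (WassersteinShrinkage.iInf_sdpObjective_eq hS X).symm⟩
  · rw [heq m S hS]
    exact ⟨WassersteinShrinkage.convexValue_ne_bot hp hρ hS,
      WassersteinShrinkage.convexValue_ne_top hp h𝒳 hne⟩
  · rw [heq m₁ S hS, heq m₂ S hS]
  · exact (WassersteinShrinkage.continuousOn_convexValue hp hρ).congr fun S hS => heq m S hS
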